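/- Let $n\in\mathbb N$ be positive. A \emph{configuration of size $n$} is a circular sequence (a word up to cyclic rotation) with exactly $n$ red and $n$ blue entries. Its maximal monochromatic blocks alternate in color, so that it can be written as $(r_1,b_1,r_2,b_2,\dots,r_a,b_a)$, where $r_i\ge 1$ and $b_i\ge 1$ are the sizes of consecutive red and blue blocks; $a$ is its \emph{alternation number}. Let $R$ and $B$ be disjoint sets of $n$ red and $n$ blue points in the plane. A configuration $C$ is \emph{feasible} from $(R,B)$ if one can choose for every point $p\in R\cup B$ a closed ray with apex $p$ such that these $2n$ rays are pairwise disjoint and such that the colors of the apices of the rays, read in clockwise order along a circle enclosing $R\cup B$ at the points where the rays meet the circle, form the circular sequence $C$. A configuration of size $n$ is \emph{universal} if it is feasible from every such pair $(R,B)$ with $|R|=|B|=n$. For $\lambda>0$ let $K_\lambda(n)=\{\lambda z: z\in\mathbb C,\ z^n=1\}$, as a set of points of the plane. \textbf{Theorem.} Let $k,l$ be positive real numbers, and for every $n$ let $\mathcal C_n$ be the set of all configurations of size $n$ that have alternation number at least three, all of whose red blocks have size at least $n/k$ and all of whose blue blocks have size at least $n/l$. Then there exists $n_0\in\mathbb N$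 such that for every $n>n_0$ no configuration in $\mathcal C_n$ is universal. More precisely, for every $n>n_0$ there is a real number $\lambda>1$ such that no configuration in $\mathcal C_n$ is feasible from $R=K_1(n)$, $B=K_\lambda(n)$. In particular, for every integer $k\ge 3$ there exists $n_0$ such that for every $n>n_0$ divisible by $k$ the uniform configuration $(n/k,n/k,\dots,n/k,n/k)$ with $k$ red and $k$ blue blocks is not universal. -/

import Mathlib

noncomputable section

namespace ColoredRays

/-- The two colors; the alphabet `{r, b}`. -/
inductive Color
  | red
  | blue
  deriving DecidableEq

/-- The circular sequence `(r₁, b₁, r₂, b₂, …, rₖ, bₖ)`: `r₁` red positions, then `b₁` blue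
positions, and so on, up to cyclic rotation. The list holds the pairs `(rᵢ, bᵢ)`. -/
def ofBlocks (bl : List (ℕ × ℕ)) : Cycle Color :=
  ((bl.flatMap fun rb =>
    List.replicate rb.1 Color.red ++ List.replicate rb.2 Color.blue : List Color) : Cycle Color)

/-- A configuration: a circular sequence with `n` red and `n` blue elements. -/
def IsConfiguration (n : ℕ) (C : Cycle Color) : Prop :=
  C.toMultiset.count Color.red = n ∧ C.toMultiset.count Color.blue = n

/-- `bl = [(r₁, b₁), …, (rₖ, bₖ)]` lists the sizes of the (nonempty, maximal) monochromatic blocks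
of `C` in circular order. The alternation number of `C` is `k = bl.length`. -/
def IsBlockForm (C : Cycle Color) (bl : List (ℕ × ℕ)) : Prop :=
  (∀ rb ∈ bl, 0 < rb.1 ∧ 0 < rb.2) ∧ C = ofBlocks bl

/-- The closed ray with apex `p` and direction `v`; the plane is `ℂ`. -/
def ray (p v : ℂ) : Set ℂ := {z | ∃ t : ℝ, 0 ≤ t ∧ z = p + (t : ℂ) * v}

/-- The circular sequence of colors induced at infinity by the rays `ray p (d p)`, `p ∈ R ∪ B`,
each with the color of its apex, is `C`: some circle about the origin encloses `R ∪ B`, and `C`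
is the sequence of the colors of the points where the rays meet it, in clockwise order (that is,
with decreasing angles, once around). -/
def InducesAtInfinity (R B : Finset ℂ) (d : ℂ → ℂ) (C : Cycle Color) : Prop :=
  ∃ ρ : ℝ, (∀ p ∈ R ∪ B, ‖p‖ < ρ) ∧
    ∃ (m : ℕ) (p : Fin m → ℂ) (θ : Fin m → ℝ),
      Function.Injective p ∧ Set.range p = (↑(R ∪ B) : Set ℂ) ∧
      (∀ i, (ρ : ℂ) * Complex.exp ((θ i : ℂ) * Complex.I) ∈ ray (p i) (d (p i))) ∧
      StrictAnti θ ∧ (∀ i j, θ i - θ j < 2 * Real.pi) ∧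
      C = ((List.ofFn fun i => if p i ∈ R then Color.red else Color.blue : List Color) :
        Cycle Color)

/-- `C` is feasible from the bichromatic point set with red points `R` and blue points `B`: one can
shoot one ray from each point such that the rays are pairwise disjoint and induce `C`. -/
def Feasible (R B : Finset ℂ) (C : Cycle Color) : Prop :=
  ∃ d : ℂ → ℂ, (∀ p ∈ R ∪ B, d p ≠ 0) ∧
    (∀ p ∈ R ∪ B, ∀ q ∈ R ∪ B, p ≠ q → Disjoint (ray p (d p)) (ray q (d q))) ∧
    InducesAtInfinity R B d C

/-- `C` is feasible from every balanced bichromatic set of `n` red and `n` blue points. -/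
def IsUniversal (n : ℕ) (C : Cycle Color) : Prop :=
  ∀ R B : Finset ℂ, Disjoint R B → R.card = n → B.card = n → Feasible R B C

/-- The configurations with `n` red and `n` blue elements with alternation number at least three,
every red block of size at least `n / k` and every blue block of size at least `n / l`. -/
def largeBlockFamily (k l : ℝ) (n : ℕ) : Set (Cycle Color) :=
  {C | IsConfiguration n C ∧ ∃ bl : List (ℕ × ℕ), IsBlockForm C bl ∧ 3 ≤ bl.length ∧
    ∀ rb ∈ bl, (n : ℝ) / k ≤ (rb.1 : ℝ) ∧ (n : ℝ) / l ≤ (rb.2 : ℝ)}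

/-- The uniform configuration `(m, m, …, m, m)` with `k` red and `k` blue blocks of size `m`. -/
def uniformConfiguration (k m : ℕ) : Cycle Color := ofBlocks (List.replicate k (m, m))

/-- The `n`-th complex roots of unity, scaled by the factor `lam`. -/
def scaledRoots (lam : ℝ) (n : ℕ) : Finset ℂ :=
  (Polynomial.nthRootsFinset n (1 : ℂ)).image fun z => (lam : ℂ) * z

end ColoredRays

end

noncomputable section

namespace ColoredRays

open Complex

/-! Suppose the rays exist, with red apexes on the unit circle and blue apexes on the circle of
radius `lam`, a constant depending only on `l`. If the rays of a long red block crossed the blue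
circle within one arc of angle 2π/n, they would be disjoint rays through a tiny disc, hence almost
parallel, and their apexes almost collinear. But three well separated points of the unit circle span
a triangle of definite area (`card_le_of_close_rays`). So some blue point lies strictly between the
first and the last red ray of the block. If its ray avoided the unit disc, it would stay between
these two rays and end up inside the red block (`startAngle_order`); hence it meets the unit disc
(`exists_meet_of_red_block`).

Three red blocks give three such blue points, and two cyclically consecutive ones are at most 2π/3
apart. Disjoint rays that come from far away and meet the unit disc have nearly equal or opposite
apex directions (`abs_cross_apex_le`), so these two directions nearly agree. Every blue ray of the
block between them either meets the disc too, or has its apex in the narrow angle between them.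
Either way the apex is close to one line through the origin, and too few scaled roots of unity are
(`card_le_of_abs_cross_le`, `card_blue_block_le`). -/

/-! ### Cross products and disjoint rays. -/

/-- The planar cross product of two complex numbers. -/
def cross (u v : ℂ) : ℝ := u.re * v.im - u.im * v.re

lemma abs_cross_le (u v : ℂ) : |cross u v| ≤ ‖u‖ * ‖v‖ := by
  have h : cross u v = ((starRingEnd ℂ) u * v).im := by
    simp [cross]; ring
  rw [h]
  refine (Complex.abs_im_le_norm _).trans ?_
  simp

lemma cross_smul_eq (u v w : ℂ) :
    (cross u v : ℂ) * w = (cross w v : ℂ) * u - (cross w u : ℂ) * v := by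
  apply Complex.ext <;> simp [cross] <;> ring

lemma lineMap_mem_ray {p d X : ℂ} (hX : X ∈ ray p d) {t : ℝ} (ht : 0 ≤ t) :
    p + (t : ℂ) * (X - p) ∈ ray p d := by
  obtain ⟨s, hs, rfl⟩ := hX
  exact ⟨t * s, mul_nonneg ht hs, by push_cast; ring⟩

/-- Two disjoint rays that come close to each other are almost parallel. -/
lemma abs_cross_le_of_disjoint_ray {p q d e X Y : ℂ} {L : ℝ}
    (h : Disjoint (ray p d) (ray q e)) (hX : X ∈ ray p d) (hY : Y ∈ ray q e)
    (hXp : ‖X - p‖ ≤ L) (hYq : ‖Y - q‖ ≤ L) :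
    |cross (X - p) (Y - q)| ≤ ‖X - Y‖ * L := by
  by_contra! hlt
  set u := X - p with hu
  set v := Y - q with hv
  have hL : 0 ≤ ‖X - Y‖ * L := mul_nonneg (norm_nonneg _) ((norm_nonneg _).trans hXp)
  have hD : cross u v ≠ 0 := by
    intro h0
    rw [h0, abs_zero] at hlt
    linarith
  -- By Cramer's rule the two lines cross at parameter `1 + cross (Y - X) w / cross u v`, with `w =
  -- v` on the first line and `w = u` on the second. A large `cross u v` keeps the correction within
  -- [-1, 1], so the crossing lies on both rays.
  have key : ∀ w : ℂ, ‖w‖ ≤ L → 0 ≤ 1 + cross (Y - X) w / cross u v := by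
    intro w hw
    have h1 : |cross (Y - X) w| ≤ ‖X - Y‖ * L := by
      refine (abs_cross_le _ _).trans ?_
      rw [norm_sub_rev]
      exact mul_le_mul_of_nonneg_left hw (norm_nonneg _)
    have h2 : |cross (Y - X) w / cross u v| ≤ 1 := by
      rw [abs_div, div_le_one (abs_pos.mpr hD)]
      linarith
    have := neg_le_of_abs_le h2
    linarith
  refine Set.disjoint_left.mp h (lineMap_mem_ray hX (key v hYq)) ?_
  have hDc : (cross u v : ℂ) ≠ 0 := by exact_mod_cast hD
  have heq : p + ((1 + cross (Y - X) v / cross u v : ℝ) : ℂ) * (X - p) =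
      q + ((1 + cross (Y - X) u / cross u v : ℝ) : ℂ) * (Y - q) := by
    have := cross_smul_eq u v (Y - X)
    rw [← hu, ← hv]
    push_cast
    field_simp
    linear_combination -this + (cross u v : ℂ) * hu - (cross u v : ℂ) * hv
  rw [heq]
  exact lineMap_mem_ray hY (key u hXp)

/-! ### Following a ray from the unit circle through the concentric circles. -/

lemma norm_mul_exp_add_arg_div {ρ : ℝ} (hρ : 0 < ρ) (θ : ℝ) (z : ℂ) :
    (‖z‖ : ℂ) * exp (((θ + arg (z / (ρ * exp (θ * I))) : ℝ) : ℂ) * I) = z := by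
  set E : ℂ := ρ * exp (θ * I) with hE
  have hEn : ‖E‖ = ρ := by
    rw [hE, norm_mul, norm_exp_ofReal_mul_I, norm_real, Real.norm_of_nonneg hρ.le, mul_one]
  have hE0 : E ≠ 0 := by
    rw [← norm_pos_iff, hEn]; exact hρ
  have h := norm_mul_exp_arg_mul_I (z / E)
  rw [norm_div, hEn] at h
  have hρc : (ρ : ℂ) ≠ 0 := by exact_mod_cast hρ.ne'
  have h2 : E * (z / E) = z := by field_simp
  rw [← h] at h2
  refine Eq.trans ?_ h2
  generalize arg (z / E) = γ
  push_cast
  rw [add_mul, exp_add, hE]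
  field_simp

/-- The point at distance `s` from the origin where the ray from `p` through `E` leaves the disc of
radius `s`. -/
def exitPoint (p E : ℂ) (s : ℝ) : ℂ :=
  p + (((-(p.re * (E - p).re + p.im * (E - p).im) +
    √((p.re * (E - p).re + p.im * (E - p).im) ^ 2 + normSq (E - p) * (s ^ 2 - 1))) /
      normSq (E - p) : ℝ) : ℂ) * (E - p)

/-- The angle swept out between the exit points of the ray from `p` through `E` at radius `‖E‖`
and at radius `s`. -/
def swing (p E : ℂ) (s : ℝ) : ℝ := arg (exitPoint p E s / E)

lemma continuous_exitPoint (p E : ℂ) : Continuous (exitPoint p E) := by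
  unfold exitPoint
  fun_prop

/-- The positive real part keeps `exitPoint p E s / E` off the branch cut of `arg`, which makes
`swing` continuous in the radius. -/
lemma exitPoint_spec {p d E : ℂ} {ρ s : ℝ} (hp : ‖p‖ = 1) (hρ : 1 < ρ) (hEn : ‖E‖ = ρ)
    (hE : E ∈ ray p d) (hs : s ∈ Set.Icc 1 ρ) :
    exitPoint p E s ∈ ray p d ∧ ‖exitPoint p E s‖ = s ∧
      0 < (exitPoint p E s / E).re ∧ exitPoint p E ρ = E := by
  obtain ⟨hs1, hs2⟩ := hs
  have hu0 : E - p ≠ 0 := by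
    intro h
    rw [sub_eq_zero.mp h, hp] at hEn
    linarith
  have ha : 0 < normSq (E - p) := normSq_pos.mpr hu0
  have hp2 : p.re ^ 2 + p.im ^ 2 = 1 := by
    have := Complex.sq_norm p
    rw [hp, normSq_apply] at this
    linarith
  have hE2 : E.re ^ 2 + E.im ^ 2 = ρ ^ 2 := by
    have := Complex.sq_norm E
    rw [hEn, normSq_apply] at this
    linarith
  have hpE : p.re * E.re + p.im * E.im ≤ ρ := by
    nlinarith [sq_nonneg (p.re * E.im - p.im * E.re), sq_nonneg (p.re * E.re + p.im * E.im - ρ)]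
  have haE : normSq (E - p) = (E.re - p.re) ^ 2 + (E.im - p.im) ^ 2 := by
    rw [normSq_apply]; simp; ring
  unfold exitPoint
  set a := normSq (E - p) with hadef
  set b := p.re * (E - p).re + p.im * (E - p).im with hb
  have hb' : b = p.re * E.re + p.im * E.im - 1 := by
    rw [hb]; simp only [sub_re, sub_im]; linarith
  have hab : ρ ^ 2 = 1 + 2 * b + a := by rw [hb', haE]; nlinarith
  have habpos : 0 < a + b := by nlinarith
  have hroot : ∀ r : ℝ, 1 ≤ r → √(b ^ 2 + a * (r ^ 2 - 1)) ^ 2 = b ^ 2 + a * (r ^ 2 - 1) := by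
    intro r hr
    apply Real.sq_sqrt
    have : 0 ≤ r ^ 2 - 1 := by nlinarith
    positivity
  have hρroot : √(b ^ 2 + a * (ρ ^ 2 - 1)) = a + b := by
    rw [show b ^ 2 + a * (ρ ^ 2 - 1) = (a + b) ^ 2 by rw [hab]; ring]
    exact Real.sqrt_sq habpos.le
  have hmono : √(b ^ 2 + a * (s ^ 2 - 1)) ≤ a + b := by
    rw [← hρroot]
    apply Real.sqrt_le_sqrt
    have : s ^ 2 ≤ ρ ^ 2 := by nlinarith
    nlinarith
  have hge : b ≤ √(b ^ 2 + a * (s ^ 2 - 1)) := by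
    apply Real.le_sqrt_of_sq_le
    have : 0 ≤ s ^ 2 - 1 := by nlinarith
    have := mul_nonneg ha.le this
    linarith
  have hsq := hroot s hs1
  have hr0 := Real.sqrt_nonneg (b ^ 2 + a * (s ^ 2 - 1))
  set r := √(b ^ 2 + a * (s ^ 2 - 1)) with hr
  set t := (-b + r) / a with ht
  have hta : t * a = -b + r := by rw [ht]; field_simp
  have ht0 : 0 ≤ t := div_nonneg (by linarith) ha.le
  have ht1 : t ≤ 1 := by rw [ht, div_le_one ha]; linarith
  -- `t` is the larger root of `a t² + 2 b t + 1 - s² = 0`, which expresses that the point has norm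
  -- `s`, since `‖p‖ = 1`.
  have hx2 : normSq (p + (t : ℂ) * (E - p)) = s ^ 2 := by
    have h1 : normSq (p + (t : ℂ) * (E - p)) = 1 + 2 * t * b + t * (t * a) := by
      rw [haE, hb', normSq_apply]; simp; linear_combination (1 - 2 * t) * hp2
    rw [h1]
    have : a * (1 + 2 * t * b + t * (t * a)) = a * s ^ 2 := by
      linear_combination (2 * b + t * a - b + r) * hta + hsq
    exact mul_left_cancel₀ ha.ne' this
  refine ⟨lineMap_mem_ray hE ht0, ?_, ?_, ?_⟩
  · have : ‖p + (t : ℂ) * (E - p)‖ ^ 2 = s ^ 2 := by rw [Complex.sq_norm, hx2]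
    exact (pow_left_inj₀ (norm_nonneg _) (by linarith) two_ne_zero).mp this
  -- With X the exit point, E = X + (1 - t)(E - p), and the inner product of X with E - p is `r`.
  · have hin : (p + (t : ℂ) * (E - p)).re * E.re + (p + (t : ℂ) * (E - p)).im * E.im =
        s ^ 2 + (1 - t) * r := by
      have h1 : s ^ 2 = 1 + 2 * t * b + t * (t * a) := by
        rw [← hx2, haE, hb', normSq_apply]; simp; linear_combination (1 - 2 * t) * hp2
      have h2 : r = t * a + b := by linarith
      rw [h2, h1, haE, hb']
      simp
      linear_combination (-t) * hp2
    rw [div_re]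
    have hn : normSq E = ρ ^ 2 := by rw [← Complex.sq_norm, hEn]
    rw [hn, ← add_div, hin]
    have : 0 ≤ (1 - t) * r := mul_nonneg (by linarith) hr0
    positivity
  · rw [hρroot]
    have : (-b + (a + b)) / a = 1 := by field_simp; ring
    rw [this]; simp

lemma continuousOn_swing {p d E : ℂ} {ρ : ℝ} (hp : ‖p‖ = 1) (hρ : 1 < ρ) (hEn : ‖E‖ = ρ)
    (hE : E ∈ ray p d) : ContinuousOn (swing p E) (Set.Icc 1 ρ) := by
  intro s hs
  apply ContinuousAt.continuousWithinAt
  have h := (exitPoint_spec hp hρ hEn hE hs).2.2.1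
  exact ContinuousAt.comp (f := fun s => exitPoint p E s / E)
    (continuousAt_arg (Or.inl h)) (by
    have := continuous_exitPoint p E
    fun_prop)

/-- The angle at which the ray from `p` hits the circle of radius `s`, lifted to the reals so that
it is `θ` at radius `ρ`. -/
def angleAt (ρ : ℝ) (p : ℂ) (θ s : ℝ) : ℝ := θ + swing p (ρ * exp (θ * I)) s

lemma norm_ofReal_mul_exp {ρ : ℝ} (hρ : 0 ≤ ρ) (θ : ℝ) : ‖(ρ : ℂ) * exp (θ * I)‖ = ρ := by
  rw [norm_mul, norm_exp_ofReal_mul_I, norm_real, Real.norm_of_nonneg hρ, mul_one]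

section angleAt

variable {p d : ℂ} {ρ θ : ℝ} (hp : ‖p‖ = 1) (hρ : 1 < ρ)
  (hE : (ρ : ℂ) * exp (θ * I) ∈ ray p d)

include hp hρ hE

lemma continuousOn_angleAt : ContinuousOn (angleAt ρ p θ) (Set.Icc 1 ρ) :=
  continuousOn_const.add
    (continuousOn_swing hp hρ (norm_ofReal_mul_exp (by linarith) θ) hE)

lemma angleAt_self : angleAt ρ p θ ρ = θ := by
  have hn := norm_ofReal_mul_exp (show 0 ≤ ρ by linarith) θ
  have h := (exitPoint_spec hp hρ hn hE ⟨hρ.le, le_rfl⟩).2.2.2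
  have h0 : (ρ : ℂ) * exp (θ * I) ≠ 0 := by rw [← norm_pos_iff, hn]; linarith
  rw [angleAt, swing, h, div_self h0, arg_one, add_zero]

lemma mem_ray_angleAt {s : ℝ} (hs : s ∈ Set.Icc 1 ρ) :
    (s : ℂ) * exp ((angleAt ρ p θ s : ℂ) * I) ∈ ray p d := by
  have hn := norm_ofReal_mul_exp (show 0 ≤ ρ by linarith) θ
  obtain ⟨h1, h2, -⟩ := exitPoint_spec hp hρ hn hE hs
  have h3 := norm_mul_exp_add_arg_div (show 0 < ρ by linarith) θ
    (exitPoint p (ρ * exp (θ * I)) s)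
  rw [h2] at h3
  rw [angleAt, swing, h3]
  exact h1

end angleAt

lemma lt_iff_lt_of_ne_on {f g : ℝ → ℝ} {a b : ℝ} (hab : a ≤ b)
    (hf : ContinuousOn f (Set.Icc a b)) (hg : ContinuousOn g (Set.Icc a b))
    (hne : ∀ t ∈ Set.Icc a b, f t ≠ g t) : f a < g a ↔ f b < g b := by
  have key : ∀ f g : ℝ → ℝ, ContinuousOn f (Set.Icc a b) → ContinuousOn g (Set.Icc a b) →
      (∀ t ∈ Set.Icc a b, f t ≠ g t) → f a < g a → f b < g b := by
    intro f g hf hg hne h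
    by_contra! h'
    obtain ⟨t, ht, h0⟩ := intermediate_value_Icc hab (hf.sub hg)
      (show (0 : ℝ) ∈ Set.Icc _ _ from ⟨by simp; linarith, by simp; linarith⟩)
    exact hne t ht (by simp at h0; linarith)
  refine ⟨key f g hf hg hne, fun h => ?_⟩
  by_contra! h'
  have h1 := lt_of_le_of_ne h' (hne a ⟨le_rfl, hab⟩).symm
  have := key g f hg hf (fun t ht => (hne t ht).symm) h1
  linarith

/-- Disjoint rays from the unit circle hit all larger circles in the same order. -/
lemma angleAt_lt_iff {p q d e : ℂ} {ρ θ η s : ℝ} (hp : ‖p‖ = 1) (hq : ‖q‖ = 1) (hρ : 1 < ρ)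
    (hE : (ρ : ℂ) * exp (θ * I) ∈ ray p d) (hF : (ρ : ℂ) * exp (η * I) ∈ ray q e)
    (hd : Disjoint (ray p d) (ray q e)) (hs : s ∈ Set.Icc 1 ρ) :
    angleAt ρ p θ s < angleAt ρ q η s ↔ θ < η := by
  have hsub : Set.Icc s ρ ⊆ Set.Icc 1 ρ := Set.Icc_subset_Icc_left hs.1
  have := lt_iff_lt_of_ne_on hs.2 ((continuousOn_angleAt hp hρ hE).mono hsub)
    ((continuousOn_angleAt hq hρ hF).mono hsub) (by
      intro t ht heq
      have h1 := mem_ray_angleAt hp hρ hE (hsub ht)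
      rw [heq] at h1
      exact Set.disjoint_left.mp hd h1 (mem_ray_angleAt hq hρ hF (hsub ht)))
  rw [this, angleAt_self hp hρ hE, angleAt_self hq hρ hF]

/-! ### Rays that avoid the unit disc. -/

/-- The angle of the apex `q` of a ray that avoids the origin, lifted to the reals so that
following the ray to radius `ρ` leads to the angle `θ`. -/
def startAngle (ρ : ℝ) (q : ℂ) (θ : ℝ) : ℝ := θ + arg (q / (ρ * exp (θ * I)))

/-- A ray that avoids the unit disc keeps its position relative to a disjoint ray that starts on
the unit circle. -/
lemma startAngle_order {p q d e : ℂ} {ρ θ η : ℝ} (hp : ‖p‖ = 1) (hρ : 1 < ρ) (hqρ : ‖q‖ ≤ ρ)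
    (hE : (ρ : ℂ) * exp (θ * I) ∈ ray p d) (hF : (ρ : ℂ) * exp (η * I) ∈ ray q e)
    (hd : Disjoint (ray p d) (ray q e)) (hmiss : ∀ z ∈ ray q e, 1 < ‖z‖) :
    (angleAt ρ p θ ‖q‖ < startAngle ρ q η ↔ θ < η) ∧
      (startAngle ρ q η < angleAt ρ p θ ‖q‖ ↔ η < θ) := by
  set F : ℂ := ρ * exp (η * I) with hFdef
  have hFn : ‖F‖ = ρ := norm_ofReal_mul_exp (by linarith) η
  have hF0 : F ≠ 0 := by rw [← norm_pos_iff, hFn]; linarith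
  set z : ℝ → ℂ := fun t => q + (t : ℂ) * (F - q) with hz
  have hzc : Continuous z := by rw [hz]; fun_prop
  have hzray : ∀ t, 0 ≤ t → z t ∈ ray q e := fun t ht => lineMap_mem_ray hF ht
  have hzI : ∀ t ∈ Set.Icc (0 : ℝ) 1, ‖z t‖ ∈ Set.Icc 1 ρ := by
    intro t ht
    refine ⟨(hmiss _ (hzray t ht.1)).le, ?_⟩
    have : z t = ((1 - t : ℝ) : ℂ) * q + (t : ℂ) * F := by rw [hz]; push_cast; ring
    rw [this]
    refine (norm_add_le _ _).trans ?_
    rw [norm_mul, norm_mul, hFn, norm_real, norm_real, Real.norm_of_nonneg ht.1,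
      Real.norm_of_nonneg (by linarith [ht.2])]
    nlinarith [ht.1, ht.2]
  -- If `z t` were a nonpositive multiple of `F`, the segment from `z t` to `F` would carry the ray
  -- through the origin.
  have hslit : ∀ t ∈ Set.Icc (0 : ℝ) 1, z t / F ∈ slitPlane := by
    intro t ht
    by_contra hns
    rw [mem_slitPlane_iff, not_or, not_lt, not_not] at hns
    set c := -(z t / F).re with hc
    have hc0 : 0 ≤ c := by linarith [hns.1]
    have hzF : z t = -(c : ℂ) * F := by
      have : z t / F = -(c : ℂ) := by apply Complex.ext <;> simp [hc, hns.2]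
      rw [← this]; field_simp
    have h1c : (1 + c : ℂ) ≠ 0 := by
      have : (1 + c : ℝ) ≠ 0 := by positivity
      exact_mod_cast this
    have h0 : z ((t + c) / (1 + c)) = 0 := by
      have e1 : q + (t : ℂ) * (F - q) = -(c : ℂ) * F := hzF
      rw [hz]
      push_cast
      field_simp
      linear_combination e1
    have := hmiss _ (hzray ((t + c) / (1 + c)) (div_nonneg (by linarith [ht.1]) (by linarith)))
    rw [h0, norm_zero] at this
    linarith
  set β : ℝ → ℝ := fun t => η + arg (z t / F) with hβ
  have hβc : ContinuousOn β (Set.Icc 0 1) := by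
    refine continuousOn_const.add fun t ht => ?_
    exact (ContinuousAt.comp (f := fun t => z t / F) (continuousAt_arg (hslit t ht))
      (by fun_prop)).continuousWithinAt
  have hαc : ContinuousOn (fun t => angleAt ρ p θ ‖z t‖) (Set.Icc 0 1) :=
    (continuousOn_angleAt hp hρ hE).comp (by fun_prop) hzI
  -- The red ray is compared at the radius `‖z t‖`, which need not be monotone in `t`. Equal angles
  -- at equal radius would give a common point.
  have hne : ∀ t ∈ Set.Icc (0 : ℝ) 1, angleAt ρ p θ ‖z t‖ ≠ β t := by
    intro t ht heq
    have h1 := mem_ray_angleAt hp hρ hE (hzI t ht)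
    have h2 := norm_mul_exp_add_arg_div (show 0 < ρ by linarith) η (z t)
    rw [heq, hβ] at h1
    simp only at h1
    rw [hFdef, h2] at h1
    exact Set.disjoint_left.mp hd h1 (hzray t ht.1)
  have hz0 : z 0 = q := by simp [hz]
  have hz1 : z 1 = F := by simp [hz]
  have hβ1 : β 1 = η := by simp [hβ, hz1, div_self hF0]
  have hβ0 : β 0 = startAngle ρ q η := by simp [hβ, hz0, startAngle, hFdef]
  have r1 := lt_iff_lt_of_ne_on zero_le_one hαc hβc hne
  have r2 := lt_iff_lt_of_ne_on zero_le_one hβc hαc fun t ht => (hne t ht).symm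
  simp only [hβ1, hβ0, hz0, hz1, hFn, angleAt_self hp hρ hE] at r1 r2
  exact ⟨r1, r2⟩

lemma mul_exp_startAngle {ρ : ℝ} (hρ : 0 < ρ) (q : ℂ) (θ : ℝ) :
    (‖q‖ : ℂ) * exp ((startAngle ρ q θ : ℂ) * I) = q :=
  norm_mul_exp_add_arg_div hρ θ q

/-! ### Counting roots of unity near a line. -/

lemma cross_exp (r s φ ψ : ℝ) :
    cross (r * exp (φ * I)) (s * exp (ψ * I)) = r * s * Real.sin (ψ - φ) := by
  rw [cross, re_ofReal_mul, re_ofReal_mul, im_ofReal_mul, im_ofReal_mul, exp_ofReal_mul_I_re,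
    exp_ofReal_mul_I_re, exp_ofReal_mul_I_im, exp_ofReal_mul_I_im, Real.sin_sub]
  ring

lemma card_le_of_abs_sub_le {T : Finset ℕ} {a r : ℝ} (hr : 0 ≤ r)
    (h : ∀ i ∈ T, |(i : ℝ) - a| ≤ r) : (T.card : ℝ) ≤ 2 * r + 1 := by
  rcases T.eq_empty_or_nonempty with rfl | hT
  · simp; linarith
  · have hsub : T ⊆ Finset.Icc (T.min' hT) (T.max' hT) := fun i hi =>
      Finset.mem_Icc.mpr ⟨T.min'_le i hi, T.le_max' i hi⟩
    have hc := Finset.card_le_card hsub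
    rw [Nat.card_Icc] at hc
    have hle := T.min'_le _ (T.max'_mem hT)
    have hc' : T.card + T.min' hT ≤ T.max' hT + 1 := by omega
    have hc'' : (T.card : ℝ) + (T.min' hT : ℕ) ≤ (T.max' hT : ℕ) + 1 := by exact_mod_cast hc'
    have h1 := abs_le.mp (h _ (T.min'_mem hT))
    have h2 := abs_le.mp (h _ (T.max'_mem hT))
    linarith [h1.1, h2.2]

/-- Subtracting the nearest multiple of π preserves |sin| and leaves an angle in [-π/2, π/2], where
Jordan's inequality applies. -/
lemma exists_int_abs_sub_mul_pi_le (ψ : ℝ) :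
    |ψ - round (ψ / Real.pi) * Real.pi| ≤ Real.pi / 2 * |Real.sin ψ| := by
  have hpi := Real.pi_pos
  set κ : ℤ := round (ψ / Real.pi) with hκ
  have h1 : |ψ / Real.pi - κ| ≤ 1 / 2 := abs_sub_round _
  set x := ψ - κ * Real.pi with hx
  have hxe : x = (ψ / Real.pi - κ) * Real.pi := by rw [hx]; field_simp
  have hxle : |x| ≤ Real.pi / 2 := by
    rw [hxe, abs_mul, abs_of_pos hpi]
    nlinarith
  have h2 : |Real.sin ψ| = |Real.sin x| := by
    rw [hx, Real.sin_sub_int_mul_pi]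
    simp [abs_mul, abs_zpow]
  rw [h2]
  have h3 := Real.mul_abs_le_abs_sin hxle
  have : Real.pi / 2 * (2 / Real.pi * |x|) = |x| := by field_simp
  nlinarith

/-- Only a small proportion of the roots of unity lie close to a given line through the origin. -/
lemma card_le_of_abs_cross_le {n : ℕ} (hn : 0 < n) {S : Finset ℂ} (hS : ∀ z ∈ S, z ^ n = 1)
    {φ ε : ℝ} (hε : 0 ≤ ε) (h : ∀ z ∈ S, |cross (exp (φ * I)) z| ≤ ε) :
    (S.card : ℝ) ≤ 3 * (ε * n / 2 + 1) := by
  classical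
  have hpi := Real.pi_pos
  have hn' : (0 : ℝ) < n := by exact_mod_cast hn
  set ψ : ℕ → ℝ := fun i => 2 * Real.pi * i / n - φ with hψ
  set T : Finset ℕ := (Finset.range n).filter fun i => |Real.sin (ψ i)| ≤ ε with hT
  set κ₀ : ℤ := round (-φ / Real.pi) with hκ₀
  set U : ℤ → Finset ℕ := fun κ => T.filter fun i => round (ψ i / Real.pi) = κ with hU
  have hST : S ⊆ T.image fun i => exp (2 * Real.pi * I / n) ^ i := by
    intro z hz
    have : NeZero n := ⟨hn.ne'⟩
    obtain ⟨i, hi, hiz⟩ :=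
      (isPrimitiveRoot_exp n hn.ne').eq_pow_of_pow_eq_one (hS z hz)
    refine Finset.mem_image.mpr ⟨i, ?_, hiz⟩
    rw [hT, Finset.mem_filter, Finset.mem_range]
    refine ⟨hi, ?_⟩
    have h1 := h z hz
    have h2 : z = ((1 : ℝ) : ℂ) * exp (((2 * Real.pi * i / n : ℝ) : ℂ) * I) := by
      rw [← hiz, ← exp_nat_mul]
      push_cast
      rw [one_mul]
      congr 1
      ring
    have h3 : exp (φ * I) = ((1 : ℝ) : ℂ) * exp (φ * I) := by simp
    rw [h2, h3, cross_exp, one_mul, one_mul] at h1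
    exact h1
  have hUcard : ∀ κ, ((U κ).card : ℝ) ≤ ε * n / 2 + 1 := by
    intro κ
    -- The centre is the real index at which the angle 2πi/n equals φ + κπ.
    have : ∀ i ∈ U κ, |(i : ℝ) - n * (φ / Real.pi + κ) / 2| ≤ ε * n / 4 := by
      intro i hi
      rw [hU, Finset.mem_filter, hT, Finset.mem_filter] at hi
      have h1 := exists_int_abs_sub_mul_pi_le (ψ i)
      rw [hi.2] at h1
      have h2 : (i : ℝ) - n * (φ / Real.pi + κ) / 2 =
          n / (2 * Real.pi) * (ψ i - κ * Real.pi) := by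
        rw [hψ]; field_simp; ring
      rw [h2, abs_mul, abs_of_pos (by positivity)]
      calc n / (2 * Real.pi) * |ψ i - κ * Real.pi|
          ≤ n / (2 * Real.pi) * (Real.pi / 2 * ε) := by
            gcongr
            exact h1.trans (mul_le_mul_of_nonneg_left hi.1.2 (by positivity))
        _ = ε * n / 4 := by field_simp; ring
    have := card_le_of_abs_sub_le (by positivity) this
    linarith
  -- The angles `ψ i` fill less than a full turn, so the nearest multiple of π takes at most three
  -- values; this is the factor 3.
  have hTU : T ⊆ U κ₀ ∪ U (κ₀ + 1) ∪ U (κ₀ + 2) := by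
    intro i hi
    have hi' := hi
    rw [hT, Finset.mem_filter, Finset.mem_range] at hi'
    have hin : (i : ℝ) < n := by exact_mod_cast hi'.1
    have e1 : -φ / Real.pi ≤ ψ i / Real.pi := by
      apply div_le_div_of_nonneg_right _ hpi.le
      have : 0 ≤ 2 * Real.pi * i / n := by positivity
      simp only [hψ]; linarith
    have e2 : ψ i / Real.pi ≤ -φ / Real.pi + (2 : ℤ) := by
      rw [div_add' _ _ _ hpi.ne']
      apply div_le_div_of_nonneg_right _ hpi.le
      have : 2 * Real.pi * i / n ≤ 2 * Real.pi := by
        rw [div_le_iff₀ hn']; nlinarith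
      simp only [hψ]; push_cast; linarith
    have r1 : κ₀ ≤ round (ψ i / Real.pi) := by
      rw [hκ₀, round_eq, round_eq]
      exact Int.floor_mono (by linarith)
    have r2 : round (ψ i / Real.pi) ≤ κ₀ + 2 := by
      
      rw [hκ₀, ← round_add_intCast, round_eq, round_eq]
      exact Int.floor_mono (by linarith)
    simp only [hU, Finset.mem_union, Finset.mem_filter, hi, true_and]
    omega
  have c1 := (Finset.card_le_card hST).trans Finset.card_image_le
  have c2 := (Finset.card_le_card hTU).trans (Finset.card_union_le _ _)
  have c3 := Finset.card_union_le (U κ₀) (U (κ₀ + 1))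
  have c4 : S.card ≤ (U κ₀).card + (U (κ₀ + 1)).card + (U (κ₀ + 2)).card := by omega
  have c5 : (S.card : ℝ) ≤ (U κ₀).card + (U (κ₀ + 1)).card + (U (κ₀ + 2)).card := by
    exact_mod_cast c4
  linarith [hUcard κ₀, hUcard (κ₀ + 1), hUcard (κ₀ + 2)]

/-- Since `cross p z = cross p (z - p)`, a point close to `p` is close to the line through the
origin and `p`. -/
lemma card_filter_norm_sub_le {n : ℕ} (hn : 0 < n) {S : Finset ℂ} (hS : ∀ z ∈ S, z ^ n = 1)
    {p : ℂ} (hp : ‖p‖ = 1) {δ : ℝ} (hδ : 0 ≤ δ) :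
    ((S.filter fun z => ‖z - p‖ ≤ δ).card : ℝ) ≤ 3 * (δ * n / 2 + 1) := by
  refine card_le_of_abs_cross_le hn (φ := arg p) (fun z hz => hS z (Finset.mem_filter.mp hz).1) hδ
    fun z hz => ?_
  have h1 : exp (arg p * I) = p := by
    have := norm_mul_exp_arg_mul_I p
    rwa [hp, ofReal_one, one_mul] at this
  have h2 : cross p z = cross p (z - p) := by simp [cross]; ring
  rw [h1, h2]
  refine (abs_cross_le _ _).trans ?_
  rw [hp, one_mul]
  exact (Finset.mem_filter.mp hz).2

/-! ### Inscribed triangles and narrow bundles of rays. -/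

/-- The area of a triangle inscribed in the unit circle. -/
lemma norm_mul_norm_mul_norm_eq_cross {p q r : ℂ} (hp : ‖p‖ = 1) (hq : ‖q‖ = 1) (hr : ‖r‖ = 1) :
    ‖q - p‖ * ‖r - p‖ * ‖r - q‖ = 2 * |cross (q - p) (r - p)| := by
  have hcr : ∀ u v : ℂ, (cross u v : ℂ) * (2 * I) =
      (starRingEnd ℂ) u * v - u * (starRingEnd ℂ) v := by
    intro u v
    apply Complex.ext <;> simp [cross]
    ring
  have hne : ∀ z : ℂ, ‖z‖ = 1 → z ≠ 0 := by
    rintro z hz rfl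
    simp at hz
  have hp0 := hne p hp
  have hq0 := hne q hq
  have hr0 := hne r hr
  -- On the unit circle conjugation is inversion, so the cross product becomes a Vandermonde product
  -- divided by pqr.
  have key : (cross (q - p) (r - p) : ℂ) * (2 * I) * (p * q * r) =
      (q - p) * (r - p) * (q - r) := by
    rw [hcr, map_sub, map_sub, ← inv_eq_conj hp, ← inv_eq_conj hq, ← inv_eq_conj hr]
    field_simp
    ring
  have := congrArg norm key
  simp only [norm_mul, norm_real, hp, hq, hr, norm_I, Complex.norm_ofNat, Real.norm_eq_abs] at this
  rw [norm_sub_rev r q]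
  linarith

/-- Few pairwise disjoint rays from the roots of unity pass through a small disc. -/
lemma card_le_of_close_rays {n : ℕ} (hn : 0 < n) {S : Finset ℂ} (hS : ∀ z ∈ S, z ^ n = 1)
    {d X : ℂ → ℂ} {lam w δ : ℝ} (hδ : 0 < δ) (hX : ∀ z ∈ S, X z ∈ ray z (d z))
    (hXn : ∀ z ∈ S, ‖X z‖ ≤ lam)
    (hdisj : ∀ z ∈ S, ∀ z' ∈ S, z ≠ z' → Disjoint (ray z (d z)) (ray z' (d z')))
    (hclose : ∀ z ∈ S, ∀ z' ∈ S, ‖X z - X z'‖ ≤ w) (hw : 14 * w * (lam + 1) < δ ^ 3) :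
    (S.card : ℝ) ≤ 6 * (δ * n / 2 + 1) := by
  classical
  by_contra! hcard
  have hnS : ∀ z ∈ S, ‖z‖ = 1 := fun z hz => norm_eq_one_of_pow_eq_one (hS z hz) hn.ne'
  have hδn : 0 ≤ δ * n / 2 := by positivity
  obtain ⟨p, hp⟩ : S.Nonempty := by
    rw [← Finset.card_pos, ← Nat.cast_pos (α := ℝ)]
    linarith
  have cp := card_filter_norm_sub_le hn hS (hnS p hp) hδ.le
  obtain ⟨q, hq, hqp⟩ : ∃ q ∈ S, δ < ‖q - p‖ := by
    by_contra! hcon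
    rw [Finset.filter_true_of_mem hcon] at cp
    linarith
  have cq := card_filter_norm_sub_le hn hS (hnS q hq) hδ.le
  -- The discs of radius `δ` about `p` and `q` together hold at most 6(δn/2 + 1) points of `S`.
  obtain ⟨r, hr, hrp, hrq⟩ : ∃ r ∈ S, δ < ‖r - p‖ ∧ δ < ‖r - q‖ := by
    by_contra! hcon
    have hsub : S ⊆ (S.filter fun z => ‖z - p‖ ≤ δ) ∪ (S.filter fun z => ‖z - q‖ ≤ δ) := by
      intro z hz
      rw [Finset.mem_union, Finset.mem_filter, Finset.mem_filter]
      by_cases h : ‖z - p‖ ≤ δ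
      · exact Or.inl ⟨hz, h⟩
      · exact Or.inr ⟨hz, hcon z hz (not_le.mp h)⟩
    have c1 := (Finset.card_le_card hsub).trans (Finset.card_union_le _ _)
    have c2 : (S.card : ℝ) ≤ (S.filter fun z => ‖z - p‖ ≤ δ).card +
      (S.filter fun z => ‖z - q‖ ≤ δ).card := by exact_mod_cast c1
    linarith
  have hL : ∀ z ∈ S, ∀ z' ∈ S, ‖X z - z'‖ ≤ lam + 1 := fun z hz z' hz' =>
    (norm_sub_le _ _).trans (add_le_add (hXn z hz) (hnS z' hz').le)
  have hL0 : 0 ≤ lam + 1 := (norm_nonneg _).trans (hL p hp p hp)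
  have hne : ∀ {x y : ℂ}, δ < ‖x - y‖ → y ≠ x := by
    rintro x y h rfl
    simp at h; linarith
  have hc : ∀ z ∈ S, ∀ z' ∈ S, z ≠ z' → |cross (X z - z) (X z' - z')| ≤ w * (lam + 1) :=
    fun z hz z' hz' h => (abs_cross_le_of_disjoint_ray (hdisj z hz z' hz' h) (hX z hz) (hX z' hz')
      (hL z hz z hz) (hL z' hz' z' hz')).trans
      (mul_le_mul_of_nonneg_right (hclose z hz z' hz') hL0)
  have hb : ∀ u v : ℂ, ‖u‖ ≤ lam + 1 → ‖v‖ ≤ w → |cross u v| ≤ w * (lam + 1) := by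
    intro u v hu hv
    refine (abs_cross_le u v).trans ?_
    rw [mul_comm w]
    exact mul_le_mul hu hv (norm_nonneg _) hL0
  have hb' : ∀ u v : ℂ, ‖u‖ ≤ w → ‖v‖ ≤ lam + 1 → |cross u v| ≤ w * (lam + 1) := by
    intro u v hu hv
    exact (abs_cross_le u v).trans (mul_le_mul hu hv (norm_nonneg _) ((norm_nonneg _).trans hu))
  -- Each of the seven terms pairs two almost parallel ray vectors or contains a short vector `X z -
  -- X z'`, so it is at most w(lam + 1). Twice their sum gives the constant 14.
  have e : cross (q - p) (r - p) =
      cross (X p - p) (X q - q) + cross (X p - p) (X p - X q)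
      - cross (X p - p) (X r - r) - cross (X p - p) (X p - X r)
      + cross (X q - q) (X r - r) + cross (X q - q) (X p - X r)
      + cross (X p - X q) (X p - r) := by
    simp [cross]; ring
  have t1 := abs_le.mp (hc p hp q hq (hne hqp))
  have t2 := abs_le.mp (hb _ _ (hL p hp p hp) (hclose p hp q hq))
  have t3 := abs_le.mp (hc p hp r hr (hne hrp))
  have t4 := abs_le.mp (hb _ _ (hL p hp p hp) (hclose p hp r hr))
  have t5 := abs_le.mp (hc q hq r hr (hne hrq))
  have t6 := abs_le.mp (hb _ _ (hL q hq q hq) (hclose p hp r hr))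
  have t7 := abs_le.mp (hb' _ _ (hclose p hp q hq) (hL p hp r hr))
  have harea : |cross (q - p) (r - p)| ≤ 7 * (w * (lam + 1)) := by
    rw [abs_le, e]
    constructor <;> linarith [t1.1, t1.2, t2.1, t2.2, t3.1, t3.2, t4.1, t4.2, t5.1, t5.2, t6.1,
      t6.2, t7.1, t7.2]
  have hprod : δ ^ 3 ≤ ‖q - p‖ * ‖r - p‖ * ‖r - q‖ := by
    rw [pow_succ, pow_two]
    gcongr
  rw [norm_mul_norm_mul_norm_eq_cross (hnS p hp) (hnS q hq) (hnS r hr)] at hprod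
  linarith

/-! ### Distant rays that meet the unit disc. -/

/-- Disjoint rays that start far away and meet the unit disc start in almost the same or in almost
opposite directions. -/
lemma abs_cross_apex_le {p q d e X Y : ℂ} {lam : ℝ} (h : Disjoint (ray p d) (ray q e))
    (hp : ‖p‖ = lam) (hq : ‖q‖ = lam) (hX : X ∈ ray p d) (hY : Y ∈ ray q e)
    (hXn : ‖X‖ ≤ 1) (hYn : ‖Y‖ ≤ 1) : |cross p q| ≤ 4 * lam + 3 := by
  have h0 : 0 ≤ lam := hp ▸ norm_nonneg p
  have hL : ∀ x z : ℂ, ‖x‖ ≤ 1 → ‖z‖ = lam → ‖x - z‖ ≤ lam + 1 := fun x z hx hz =>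
    (norm_sub_le _ _).trans (by linarith)
  have h1 := abs_cross_le_of_disjoint_ray h hX hY (hL X p hXn hp) (hL Y q hYn hq)
  have h2 : ‖X - Y‖ ≤ 2 := (norm_sub_le _ _).trans (by linarith)
  have h3 : |cross (X - p) (Y - q)| ≤ 2 * (lam + 1) :=
    h1.trans (mul_le_mul_of_nonneg_right h2 (by linarith))
  -- The four terms contribute 2(lam + 1), 1, lam and lam.
  have e : cross p q = cross (X - p) (Y - q) - cross X Y + cross X q + cross p Y := by
    simp [cross]; ring
  have m1 : |cross X Y| ≤ 1 * 1 :=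
    (abs_cross_le _ _).trans (mul_le_mul hXn hYn (norm_nonneg _) zero_le_one)
  have m2 : |cross X q| ≤ 1 * lam :=
    (abs_cross_le _ _).trans (mul_le_mul hXn hq.le (norm_nonneg _) zero_le_one)
  have m3 : |cross p Y| ≤ lam * 1 :=
    (abs_cross_le _ _).trans (mul_le_mul hp.le hYn (norm_nonneg _) h0)
  rw [abs_le] at *
  rw [e]
  constructor <;> linarith [h3.1, h3.2, m1.1, m1.2, m2.1, m2.2, m3.1, m3.2]

/-! ### Unrolling the cyclic order over the integers. -/

/-- Pairwise disjoint rays from `R ∪ B`, listed clockwise along the circle of radius `ρ`, infinitely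
often in both directions with period `m`; the ray from `P j` meets the circle at the angle `θ j`. -/
structure PeriodicRays (R B : Finset ℂ) (d : ℂ → ℂ) (ρ : ℝ) (m : ℕ) (P : ℤ → ℂ) (θ : ℤ → ℝ) :
    Prop where
  mem : ∀ j, P j ∈ R ∪ B
  surj : ∀ z ∈ R ∪ B, ∃ j, P j = z
  norm_lt : ∀ z ∈ R ∪ B, ‖z‖ < ρ
  disjoint : ∀ i j, P i ≠ P j → Disjoint (ray (P i) (d (P i))) (ray (P j) (d (P j)))
  hit : ∀ j, (ρ : ℂ) * exp (θ j * I) ∈ ray (P j) (d (P j))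
  anti : StrictAnti θ
  ne : ∀ i j : ℤ, i < j → j < i + m → P i ≠ P j
  apex_add : ∀ j κ : ℤ, P (j + κ * m) = P j
  angle_add : ∀ j κ : ℤ, θ (j + κ * m) = θ j - 2 * Real.pi * κ

/-- Equality of cycles fixes the list only up to a rotation by `s`, which is absorbed into the
indexing. On the integers, the gap from the last block back to the first is then an ordinary
interval. -/
lemma exists_periodicRays {R B : Finset ℂ} {L : List Color} (hL : L ≠ [])
    (h : Feasible R B (L : Cycle Color)) :
    ∃ d ρ P θ, PeriodicRays R B d ρ L.length P θ ∧
      ∀ i : ℕ, ∀ hi : i < L.length, L[i] = if P i ∈ R then Color.red else Color.blue := by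
  obtain ⟨d, -, hdisj, ρ, hρ, m, p, θ, hinj, hrange, hhit, hanti, h2pi, hC⟩ := h
  obtain ⟨s, hs⟩ := (Cycle.coe_eq_coe.mp hC).symm
  have hlen : L.length = m := by rw [← hs]; simp
  have hmpos : 0 < m := hlen ▸ List.length_pos_iff.mpr hL
  have hm0 : (m : ℤ) ≠ 0 := by omega
  have hmZ : (0 : ℤ) < m := by omega
  let idx : ℤ → Fin m := fun j => ⟨(j % m).toNat, by
    have h1 := Int.emod_nonneg j hm0
    have h2 := Int.emod_lt_of_pos j hmZ
    omega⟩
  have idx_add : ∀ j κ : ℤ, idx (j + κ * m) = idx j := by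
    intro j κ
    simp only [idx, Int.add_mul_emod_self_right]
  have idx_val : ∀ j, ((idx j : ℕ) : ℤ) = j % m := fun j =>
    Int.toNat_of_nonneg (Int.emod_nonneg j hm0)
  have hpmem : ∀ i, p i ∈ R ∪ B := fun i => by
    have : p i ∈ Set.range p := ⟨i, rfl⟩
    rw [hrange] at this
    exact_mod_cast this
  refine ⟨d, ρ, fun j => p (idx (j + s)),
    fun j => θ (idx (j + s)) - 2 * Real.pi * (((j + s) / (m : ℤ) : ℤ) : ℝ), ?_, ?_⟩
  · rw [hlen]
    constructor
    · exact fun j => hpmem _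
    · intro z hz
      have : z ∈ Set.range p := by rw [hrange]; exact_mod_cast hz
      obtain ⟨i, rfl⟩ := this
      refine ⟨(i : ℕ) - s, ?_⟩
      congr 1
      apply Fin.ext
      zify
      rw [idx_val, sub_add_cancel]
      exact Int.emod_eq_of_lt (by omega) (by have := i.2; omega)
    · exact hρ
    · exact fun i j hij => hdisj _ (hpmem _) _ (hpmem _) hij
    · intro j
      have := hhit (idx (j + s))
      convert this using 2
      rw [exp_eq_exp_iff_exists_int]
      exact ⟨-((j + s) / (m : ℤ)), by push_cast; ring⟩
    · intro i j hij
      simp only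
      have hle : (i + s) / (m : ℤ) ≤ (j + s) / (m : ℤ) := Int.ediv_le_ediv hmZ (by omega)
      rcases hle.eq_or_lt with heq | hlt
      · rw [heq]
        have : idx (i + s) < idx (j + s) := by
          rw [Fin.lt_def]
          zify
          rw [idx_val, idx_val]
          have e1 := Int.emod_add_mul_ediv (i + s) m
          have e2 := Int.emod_add_mul_ediv (j + s) m
          rw [heq] at e1
          omega
        linarith [hanti this]
      -- The angles of one period spread over less than 2π, so the drop of 2π per period keeps the
      -- sequence decreasing.
      · have h1 : (((i + s) / (m : ℤ) : ℤ) : ℝ) + 1 ≤ (((j + s) / (m : ℤ) : ℤ) : ℝ) := by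
          exact_mod_cast hlt
        have h2 := h2pi (idx (j + s)) (idx (i + s))
        nlinarith [Real.pi_pos]
    · intro i j hij hjm heq
      have h1 := congrArg (fun x : Fin m => ((x : ℕ) : ℤ)) (hinj heq)
      simp only [idx_val] at h1
      have h2 : (m : ℤ) ∣ (j + s) - (i + s) := Int.ModEq.dvd h1
      have := Int.le_of_dvd (by omega) h2
      omega
    · intro j κ
      rw [add_right_comm, idx_add]
    · intro j κ
      rw [add_right_comm, idx_add, Int.add_mul_ediv_right _ _ hm0]
      push_cast
      ring
  · intro i hi
    have hi' : i < ((List.ofFn fun i => if p i ∈ R then Color.red else Color.blue).rotate s).length := by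
      rw [List.length_rotate, List.length_ofFn]; omega
    have h1 : L[i] = ((List.ofFn fun i => if p i ∈ R then Color.red else Color.blue).rotate s)[i] := by
      simp only [hs]
    rw [h1, List.getElem_rotate, List.getElem_ofFn]
    have : (⟨(i + s) % (List.ofFn fun i => if p i ∈ R then Color.red else Color.blue).length, by
        simpa using Nat.mod_lt _ hmpos⟩ : Fin m) = idx (i + s) := by
      apply Fin.ext
      zify
      rw [idx_val]
      simp
    rw [this]

/-! ### The two point sets and shifts of angles by full turns. -/

lemma mem_scaledRoots {lam : ℝ} {n : ℕ} (hn : 0 < n) {z : ℂ} :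
    z ∈ scaledRoots lam n ↔ ∃ w : ℂ, w ^ n = 1 ∧ (lam : ℂ) * w = z := by
  simp [scaledRoots, Polynomial.mem_nthRootsFinset hn]

lemma mem_scaledRoots_one {n : ℕ} (hn : 0 < n) {z : ℂ} :
    z ∈ scaledRoots 1 n ↔ z ^ n = 1 := by
  simp [mem_scaledRoots hn]

lemma norm_of_mem_scaledRoots {lam : ℝ} (hlam : 0 ≤ lam) {n : ℕ} (hn : 0 < n) {z : ℂ}
    (hz : z ∈ scaledRoots lam n) : ‖z‖ = lam := by
  obtain ⟨w, hw, rfl⟩ := (mem_scaledRoots hn).mp hz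
  rw [norm_mul, norm_eq_one_of_pow_eq_one hw hn.ne', norm_real, Real.norm_of_nonneg hlam, mul_one]

lemma disjoint_scaledRoots {lam : ℝ} (hlam : 1 < lam) {n : ℕ} (hn : 0 < n) :
    Disjoint (scaledRoots 1 n) (scaledRoots lam n) := by
  rw [Finset.disjoint_left]
  intro z hz hz'
  have h1 := norm_of_mem_scaledRoots zero_le_one hn hz
  have h2 := norm_of_mem_scaledRoots (by linarith) hn hz'
  linarith

lemma card_scaledRoots {lam : ℝ} (hlam : 0 < lam) {n : ℕ} (hn : 0 < n) :
    (scaledRoots lam n).card = n := by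
  rw [scaledRoots, Finset.card_image_of_injective]
  · exact (isPrimitiveRoot_exp n hn.ne').card_nthRootsFinset
  · exact mul_right_injective₀ (by exact_mod_cast hlam.ne')

lemma exp_sub_two_pi_mul_int (θ : ℝ) (κ : ℤ) :
    exp (((θ - 2 * Real.pi * κ : ℝ) : ℂ) * I) = exp (θ * I) := by
  rw [exp_eq_exp_iff_exists_int]
  exact ⟨-κ, by push_cast; ring⟩

lemma angleAt_sub (ρ : ℝ) (p : ℂ) (θ s : ℝ) (κ : ℤ) :
    angleAt ρ p (θ - 2 * Real.pi * κ) s = angleAt ρ p θ s - 2 * Real.pi * κ := by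
  rw [angleAt, angleAt, exp_sub_two_pi_mul_int]
  ring

lemma startAngle_sub (ρ : ℝ) (q : ℂ) (θ : ℝ) (κ : ℤ) :
    startAngle ρ q (θ - 2 * Real.pi * κ) = startAngle ρ q θ - 2 * Real.pi * κ := by
  rw [startAngle, startAngle, exp_sub_two_pi_mul_int]
  ring

lemma norm_mul_exp_sub_le {lam : ℝ} (hlam : 0 ≤ lam) (a b : ℝ) :
    ‖(lam : ℂ) * exp (a * I) - lam * exp (b * I)‖ ≤ lam * |a - b| := by
  rw [← mul_sub, norm_mul, norm_real, Real.norm_of_nonneg hlam]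
  refine mul_le_mul_of_nonneg_left ?_ hlam
  have h1 : exp (a * I) - exp (b * I) = exp (b * I) * (exp (I * ((a - b : ℝ) : ℂ)) - 1) := by
    rw [mul_sub, ← exp_add, mul_one]
    congr 2
    push_cast
    ring
  rw [h1, norm_mul, norm_exp_ofReal_mul_I, one_mul]
  exact Real.norm_exp_I_mul_ofReal_sub_one_le

/-! ### Red blocks, trapped blue points and short blue blocks. -/

namespace PeriodicRays

variable {n m : ℕ} {lam ρ : ℝ} {d : ℂ → ℂ} {P : ℤ → ℂ} {θ : ℤ → ℝ}
  (hP : PeriodicRays (scaledRoots 1 n) (scaledRoots lam n) d ρ m P θ)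
  (hn : 0 < n) (hlam : 1 < lam)

include hP hn hlam

lemma lam_lt : lam < ρ := by
  have h : (lam : ℂ) * 1 ∈ scaledRoots lam n := (mem_scaledRoots hn).mpr ⟨1, one_pow n, rfl⟩
  have := hP.norm_lt _ (Finset.mem_union_right _ h)
  rwa [norm_of_mem_scaledRoots (by linarith) hn h] at this

lemma lam_mem : lam ∈ Set.Icc 1 ρ := ⟨hlam.le, (hP.lam_lt hn hlam).le⟩

lemma one_lt_radius : 1 < ρ := hlam.trans (hP.lam_lt hn hlam)

lemma angleAt_lt {i j : ℤ} (hi : P i ∈ scaledRoots 1 n) (hj : P j ∈ scaledRoots 1 n)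
    (hij : i < j) (hjm : j < i + m) :
    angleAt ρ (P j) (θ j) lam < angleAt ρ (P i) (θ i) lam := by
  rw [angleAt_lt_iff (norm_of_mem_scaledRoots zero_le_one hn hj)
    (norm_of_mem_scaledRoots zero_le_one hn hi) (hP.one_lt_radius hn hlam) (hP.hit j) (hP.hit i)
    (hP.disjoint j i (hP.ne i j hij hjm).symm) (hP.lam_mem hn hlam)]
  exact hP.anti hij

lemma blue_eq {j : ℤ} (hj : P j ∈ scaledRoots lam n) :
    P j = lam * exp ((startAngle ρ (P j) (θ j) : ℂ) * I) := by
  have h := mul_exp_startAngle (show 0 < ρ by linarith [hP.one_lt_radius hn hlam]) (P j) (θ j)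
  rw [norm_of_mem_scaledRoots (by linarith) hn hj] at h
  exact h.symm

/-- The inequalities between indices and between angles are reversed because the indices run
clockwise. -/
lemma startAngle_order_of_miss {i j : ℤ} (hi : P i ∈ scaledRoots 1 n)
    (hj : P j ∈ scaledRoots lam n) (hmiss : ¬ ∃ X ∈ ray (P j) (d (P j)), ‖X‖ ≤ 1) :
    (angleAt ρ (P i) (θ i) lam < startAngle ρ (P j) (θ j) ↔ j < i) ∧
      (startAngle ρ (P j) (θ j) < angleAt ρ (P i) (θ i) lam ↔ i < j) := by
  push Not at hmiss
  have hne : P i ≠ P j := by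
    intro h
    exact Finset.disjoint_left.mp (disjoint_scaledRoots hlam hn) hi (h ▸ hj)
  have h := startAngle_order (norm_of_mem_scaledRoots zero_le_one hn hi)
    (hP.one_lt_radius hn hlam) (hP.norm_lt _ (hP.mem j)).le (hP.hit i) (hP.hit j)
    (hP.disjoint i j hne) hmiss
  rw [norm_of_mem_scaledRoots (by linarith) hn hj] at h
  rw [h.1, h.2]
  exact ⟨hP.anti.lt_iff_gt, hP.anti.lt_iff_gt⟩

/-- The rays of a long red block fan out over more than one gap between consecutive blue points. -/
lemma two_pi_div_lt_of_red_block {x : ℤ} {N : ℕ} (hNm : N ≤ m)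
    (hred : ∀ i, x ≤ i → i < x + N → P i ∈ scaledRoots 1 n) {δ : ℝ} (hδ : 0 < δ)
    (hN : 6 * (δ * n / 2 + 1) < N)
    (hw : 14 * (lam * (2 * Real.pi / n)) * (lam + 1) < δ ^ 3) :
    2 * Real.pi / n < angleAt ρ (P x) (θ x) lam -
      angleAt ρ (P (x + N - 1)) (θ (x + N - 1)) lam := by
  classical
  by_contra! hle
  set A : ℤ → ℝ := fun i => angleAt ρ (P i) (θ i) lam with hA
  have hbetween : ∀ i, x ≤ i → i < x + N → A (x + N - 1) ≤ A i ∧ A i ≤ A x := by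
    intro i hi1 hi2
    constructor
    · rcases (show i ≤ x + N - 1 by omega).eq_or_lt with rfl | h
      · exact le_rfl
      · exact (hP.angleAt_lt hn hlam (hred _ hi1 hi2) (hred _ (by omega) (by omega)) h
          (by omega)).le
    · rcases hi1.eq_or_lt with rfl | h
      · exact le_rfl
      · exact (hP.angleAt_lt hn hlam (hred _ le_rfl (by omega)) (hred _ hi1 hi2) h (by omega)).le
  set S : Finset ℂ := (Finset.Ico x (x + N)).image P with hS
  have hScard : S.card = N := by
    rw [hS, Finset.card_image_of_injOn]
    · simp
    · intro i hi j hj hij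
      simp only [Finset.coe_Ico, Set.mem_Ico] at hi hj
      by_contra hne
      rcases lt_or_gt_of_ne hne with h | h
      · exact hP.ne i j h (by omega) hij
      · exact hP.ne j i h (by omega) hij.symm
  have hmem : ∀ z ∈ S, ∃ i, x ≤ i ∧ i < x + N ∧ P i = z := by
    intro z hz
    obtain ⟨i, hi, rfl⟩ := Finset.mem_image.mp hz
    rw [Finset.mem_Ico] at hi
    exact ⟨i, hi.1, hi.2, rfl⟩
  choose! g hg1 hg2 hg3 using hmem
  have hcard := card_le_of_close_rays hn (S := S) (d := d)
    (X := fun z => lam * exp ((A (g z) : ℂ) * I)) (lam := lam) (w := lam * (2 * Real.pi / n))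
    (fun z hz => by
      rw [← mem_scaledRoots_one hn, ← hg3 z hz]
      exact hred _ (hg1 z hz) (hg2 z hz)) hδ
    (fun z hz => by
      have := mem_ray_angleAt (norm_of_mem_scaledRoots zero_le_one hn
        (hred _ (hg1 z hz) (hg2 z hz))) (hP.one_lt_radius hn hlam) (hP.hit (g z))
        (hP.lam_mem hn hlam)
      rw [hA]
      convert this using 2 <;> rw [hg3 z hz])
    (fun z hz => (norm_ofReal_mul_exp (by linarith) _).le)
    (fun z hz z' hz' h => by
      rw [← hg3 z hz, ← hg3 z' hz'] at h ⊢
      exact hP.disjoint _ _ h)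
    (fun z hz z' hz' => by
      refine (norm_mul_exp_sub_le (by linarith) _ _).trans ?_
      refine mul_le_mul_of_nonneg_left ?_ (by linarith)
      have h1 := hbetween _ (hg1 z hz) (hg2 z hz)
      have h2 := hbetween _ (hg1 z' hz') (hg2 z' hz')
      rw [abs_le]
      constructor <;> linarith [h1.1, h1.2, h2.1, h2.2])
    hw
  rw [hScard] at hcard
  linarith

/-- Behind each long red block there is a blue point whose ray meets the unit disc. -/
lemma exists_meet_of_red_block {x : ℤ} {N : ℕ} (hN0 : 0 < N) (hNm : N ≤ m)
    (hred : ∀ i, x ≤ i → i < x + N → P i ∈ scaledRoots 1 n) {δ : ℝ} (hδ : 0 < δ)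
    (hN : 6 * (δ * n / 2 + 1) < N)
    (hw : 14 * (lam * (2 * Real.pi / n)) * (lam + 1) < δ ^ 3) :
    ∃ (j : ℤ) (φ : ℝ), P j = lam * exp (φ * I) ∧ (∃ X ∈ ray (P j) (d (P j)), ‖X‖ ≤ 1) ∧
      angleAt ρ (P (x + N - 1)) (θ (x + N - 1)) lam < φ ∧ φ < angleAt ρ (P x) (θ x) lam := by
  have hgap := hP.two_pi_div_lt_of_red_block hn hlam hNm hred hδ hN hw
  have hx := hred x le_rfl (by omega)
  have hl := hred (x + N - 1) (by omega) (by omega)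
  have hn' : (0 : ℝ) < n := by exact_mod_cast hn
  have hpi := Real.pi_pos
  set a := angleAt ρ (P (x + N - 1)) (θ (x + N - 1)) lam with ha
  -- `φ` is the first multiple of 2π/n strictly above `a`, hence the angle of a blue point.
  set h : ℤ := ⌊a / (2 * Real.pi / n)⌋ + 1 with hh
  set φ : ℝ := h * (2 * Real.pi / n) with hφ
  have hstep : 0 < 2 * Real.pi / n := by positivity
  have h1 : a < φ := by
    rw [hφ, ← div_lt_iff₀ hstep, hh]
    push_cast
    exact Int.lt_floor_add_one _
  have h2 : φ < angleAt ρ (P x) (θ x) lam := by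
    have : (⌊a / (2 * Real.pi / n)⌋ : ℝ) * (2 * Real.pi / n) ≤ a := by
      rw [← le_div_iff₀ hstep]; exact Int.floor_le _
    have e : φ = ⌊a / (2 * Real.pi / n)⌋ * (2 * Real.pi / n) + 2 * Real.pi / n := by
      rw [hφ, hh]; push_cast; ring
    linarith
  have hq : (lam : ℂ) * exp (φ * I) ∈ scaledRoots lam n := by
    refine (mem_scaledRoots hn).mpr ⟨exp (φ * I), ?_, rfl⟩
    rw [← exp_nat_mul, exp_eq_one_iff]
    refine ⟨h, ?_⟩
    rw [hφ]
    push_cast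
    have : (n : ℂ) ≠ 0 := by exact_mod_cast hn.ne'
    field_simp
  obtain ⟨j₀, hj₀⟩ := hP.surj _ (Finset.mem_union_right _ hq)
  rw [← hj₀] at hq
  by_cases hmeet : ∃ X ∈ ray (P j₀) (d (P j₀)), ‖X‖ ≤ 1
  · exact ⟨j₀, φ, hj₀, hmeet, h1, h2⟩
  exfalso
  have hb := hP.blue_eq hn hlam hq
  rw [hj₀] at hb
  have hlam0 : (lam : ℂ) ≠ 0 := by exact_mod_cast (show lam ≠ 0 by linarith)
  obtain ⟨κ, hκ⟩ := exp_eq_exp_iff_exists_int.mp (mul_left_cancel₀ hlam0 hb)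
  have hκ' : φ = startAngle ρ (P j₀) (θ j₀) + 2 * Real.pi * κ := by
    have : (φ : ℂ) * I = ((startAngle ρ (P j₀) (θ j₀) + 2 * Real.pi * κ : ℝ) : ℂ) * I := by
      rw [hκ, hj₀]; push_cast; ring
    exact_mod_cast mul_right_cancel₀ I_ne_zero this
  -- Shifting by `κ` periods makes the lifted apex angle equal to `φ` itself, not only modulo 2π.
  set j := j₀ + (-κ) * m with hj
  have hPj : P j = P j₀ := hP.apex_add _ _
  have hstart : startAngle ρ (P j) (θ j) = φ := by
    rw [hPj, hj, hP.angle_add, startAngle_sub, hκ']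
    push_cast
    ring
  rw [← hPj] at hq hmeet
  have o1 := (hP.startAngle_order_of_miss hn hlam hx hq hmeet).2
  have o2 := (hP.startAngle_order_of_miss hn hlam hl hq hmeet).1
  rw [hstart] at o1 o2
  -- The blue index `j` lies strictly between the first and last indices of the red block.
  exact Finset.disjoint_left.mp (disjoint_scaledRoots hlam hn)
    (hred j (o1.mp h2).le (by have := o2.mp h1; omega)) hq

-- The bound `4 * lam + 3` on the cross product is divided by `lam ^ 2`; `3 ≤ lam` absorbs the 3.
omit hn in
lemma abs_sin_le_of_meet {i j : ℤ} {φ ψ : ℝ} (hi : P i = lam * exp (φ * I))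
    (hj : P j = lam * exp (ψ * I)) (hlam3 : 3 ≤ lam)
    (hmi : ∃ X ∈ ray (P i) (d (P i)), ‖X‖ ≤ 1) (hmj : ∃ X ∈ ray (P j) (d (P j)), ‖X‖ ≤ 1) :
    |Real.sin (ψ - φ)| ≤ 5 / lam := by
  have hc : |cross (P i) (P j)| ≤ 4 * lam + 3 := by
    by_cases h : P i = P j
    · have : cross (P j) (P j) = 0 := by simp [cross]; ring
      rw [h, this, abs_zero]
      linarith
    · obtain ⟨X, hX, hX1⟩ := hmi
      obtain ⟨Y, hY, hY1⟩ := hmj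
      exact abs_cross_apex_le (hP.disjoint i j h)
        (by rw [hi]; exact norm_ofReal_mul_exp (by linarith) _)
        (by rw [hj]; exact norm_ofReal_mul_exp (by linarith) _) hX hY hX1 hY1
  rw [hi, hj, cross_exp, abs_mul, abs_of_pos (by positivity)] at hc
  rw [le_div_iff₀ (by linarith)]
  have : lam * (|Real.sin (ψ - φ)| * lam) ≤ lam * 5 := by linarith
  exact le_of_mul_le_mul_left this (by linarith)

/-- A blue block squeezed between two red blocks in almost the same direction is short. -/
lemma card_blue_block_le {l y x : ℤ} {M : ℕ} (hl : P l ∈ scaledRoots 1 n)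
    (hx : P x ∈ scaledRoots 1 n) (hly : l < y) (hyx : y + M ≤ x) (hxl : x < l + m)
    (hblue : ∀ i, y ≤ i → i < y + M → P i ∈ scaledRoots lam n) (hlam10 : 10 ≤ lam)
    {j₁ j₂ : ℤ} {φ₁ φ₂ : ℝ} (hj₁ : P j₁ = lam * exp (φ₁ * I)) (hj₂ : P j₂ = lam * exp (φ₂ * I))
    (hm₁ : ∃ X ∈ ray (P j₁) (d (P j₁)), ‖X‖ ≤ 1) (hm₂ : ∃ X ∈ ray (P j₂) (d (P j₂)), ‖X‖ ≤ 1)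
    (h₁ : angleAt ρ (P l) (θ l) lam < φ₁) (h₂ : φ₂ < angleAt ρ (P x) (θ x) lam)
    (h₁₂ : φ₁ - φ₂ ≤ 2 * Real.pi / 3) : (M : ℝ) ≤ 3 * (5 / lam * n / 2 + 1) := by
  classical
  have hpi := Real.pi_pos
  have hlam0 : (lam : ℂ) ≠ 0 := by exact_mod_cast (show lam ≠ 0 by linarith)
  have hsin := hP.abs_sin_le_of_meet hlam hj₂ hj₁ (by linarith) hm₂ hm₁
  have hε : 5 / lam ≤ 1 / 2 := by rw [div_le_div_iff₀] <;> linarith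
  have hxl' := hP.angleAt_lt hn hlam hl hx (by omega) hxl
  -- A gap between π/2 and 2π/3 would have sine at least 2/3, whereas 5/lam ≤ 1/2.
  have hhalf : φ₁ - φ₂ ≤ Real.pi / 2 := by
    by_contra! hgt
    have := Real.mul_le_sin (x := Real.pi - (φ₁ - φ₂)) (by linarith) (by linarith)
    rw [Real.sin_pi_sub] at this
    have h3 : 2 / Real.pi * (Real.pi / 3) ≤ 2 / Real.pi * (Real.pi - (φ₁ - φ₂)) := by
      gcongr; linarith
    have h4 : 2 / Real.pi * (Real.pi / 3) = 2 / 3 := by field_simp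
    have := (abs_le.mp hsin).2
    linarith
  have key : ∀ i, y ≤ i → i < y + M →
      |Real.sin (startAngle ρ (P i) (θ i) - φ₁)| ≤ 5 / lam := by
    intro i hi1 hi2
    have hb := hblue i hi1 hi2
    by_cases hmeet : ∃ X ∈ ray (P i) (d (P i)), ‖X‖ ≤ 1
    · exact hP.abs_sin_le_of_meet hlam hj₁ (hP.blue_eq hn hlam hb) (by linarith) hm₁ hmeet
    -- A ray missing the disc has its apex angle between the two red rays, hence between `φ₂` and
    -- `φ₁`, and sine is monotone on [0, π/2].
    · have o1 := (hP.startAngle_order_of_miss hn hlam hl hb hmeet).2.mpr (by omega)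
      have o2 := (hP.startAngle_order_of_miss hn hlam hx hb hmeet).1.mpr (by omega)
      set ψ := startAngle ρ (P i) (θ i)
      rw [← neg_sub φ₁ ψ, Real.sin_neg, abs_neg, abs_of_nonneg (Real.sin_nonneg_of_nonneg_of_le_pi (by linarith)
        (by linarith))]
      refine le_trans ?_ ((le_abs_self _).trans hsin)
      exact Real.sin_le_sin_of_le_of_le_pi_div_two (by linarith) hhalf (by linarith)
  set S : Finset ℂ := (Finset.Ico y (y + M)).image fun i => P i / lam with hS
  have hScard : S.card = M := by
    rw [hS, Finset.card_image_of_injOn]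
    · simp
    · intro i hi j hj hij
      simp only [Finset.coe_Ico, Set.mem_Ico] at hi hj
      have hij' : P i = P j := (div_left_inj' hlam0).mp hij
      by_contra hne
      rcases lt_or_gt_of_ne hne with h | h
      · exact hP.ne i j h (by omega) hij'
      · exact hP.ne j i h (by omega) hij'.symm
  have := card_le_of_abs_cross_le hn (S := S) (φ := φ₁) (ε := 5 / lam)
    (fun z hz => by
      obtain ⟨i, hi, rfl⟩ := Finset.mem_image.mp hz
      rw [Finset.mem_Ico] at hi
      obtain ⟨w, hw, hwP⟩ := (mem_scaledRoots hn).mp (hblue i hi.1 hi.2)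
      rw [← hwP, mul_div_cancel_left₀ _ hlam0, hw]) (by positivity)
    (fun z hz => by
      obtain ⟨i, hi, rfl⟩ := Finset.mem_image.mp hz
      rw [Finset.mem_Ico] at hi
      have h1 := key i hi.1 hi.2
      have h2 := cross_exp 1 1 φ₁ (startAngle ρ (P i) (θ i))
      rw [ofReal_one, one_mul, one_mul, one_mul, one_mul] at h2
      rw [hP.blue_eq hn hlam (hblue i hi.1 hi.2), mul_div_cancel_left₀ _ hlam0, h2]
      exact h1)
  rwa [hScard] at this

/-- Three long red blocks cannot be separated by three long blue blocks. -/
lemma false_of_long_blocks {r b : Fin 3 → ℕ} (hlam10 : 10 ≤ lam)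
    (hm : r 0 + b 0 + r 1 + b 1 + r 2 + b 2 ≤ m)
    {x : Fin 3 → ℤ} (hx1 : x 1 = x 0 + r 0 + b 0) (hx2 : x 2 = x 1 + r 1 + b 1)
    (hred : ∀ a i, x a ≤ i → i < x a + r a → P i ∈ scaledRoots 1 n)
    (hblue : ∀ a i, x a + r a ≤ i → i < x a + r a + b a → P i ∈ scaledRoots lam n)
    {δ : ℝ} (hδ : 0 < δ) (hr : ∀ a, 6 * (δ * n / 2 + 1) < r a)
    (hw : 14 * (lam * (2 * Real.pi / n)) * (lam + 1) < δ ^ 3)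
    (hb : ∀ a, 3 * (5 / lam * n / 2 + 1) < b a) : False := by
  have hr0 : ∀ a, 0 < r a := by
    intro a
    have h1 : 0 ≤ δ * n / 2 := by positivity
    have : (0 : ℝ) < r a := by linarith [hr a]
    exact_mod_cast this
  have hr0' := hr0 0
  have hr1' := hr0 1
  have hr2' := hr0 2
  have hrm : ∀ a, r a ≤ m := by
    intro a
    fin_cases a <;> simp <;> omega
  choose j φ hj hmeet hlo hhi using fun a =>
    hP.exists_meet_of_red_block hn hlam (hr0 a) (hrm a) (hred a) hδ (hr a) hw
  have hfirst : ∀ a, P (x a) ∈ scaledRoots 1 n := fun a =>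
    hred a _ le_rfl (by have := hr0 a; omega)
  have hlast : ∀ a, P (x a + r a - 1) ∈ scaledRoots 1 n := fun a =>
    hred a _ (by have := hr0 a; omega) (by omega)
  have hP3 : P (x 0 + 1 * m) = P (x 0) := hP.apex_add _ _
  have hθ3 : θ (x 0 + 1 * m) = θ (x 0) - 2 * Real.pi * (1 : ℤ) := hP.angle_add _ _
  have hA3 : angleAt ρ (P (x 0 + 1 * m)) (θ (x 0 + 1 * m)) lam =
      angleAt ρ (P (x 0)) (θ (x 0)) lam - 2 * Real.pi := by
    rw [hP3, hθ3, angleAt_sub]; simp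
  have hj3 : P (j 0) = lam * exp (((φ 0 - 2 * Real.pi * (1 : ℤ) : ℝ) : ℂ) * I) := by
    rw [exp_sub_two_pi_mul_int]; exact hj 0
  -- The three gaps around the circle add up to 2π.
  have hcases : φ 0 - φ 1 ≤ 2 * Real.pi / 3 ∨ φ 1 - φ 2 ≤ 2 * Real.pi / 3 ∨
      φ 2 - (φ 0 - 2 * Real.pi * (1 : ℤ)) ≤ 2 * Real.pi / 3 := by
    by_contra! h
    obtain ⟨h1, h2, h3⟩ := h
    push_cast at h3
    linarith
  rcases hcases with h | h | h
  · exact (hb 0).not_ge (hP.card_blue_block_le hn hlam (hlast 0) (hfirst 1) (by omega) (by omega)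
      (by omega) (hblue 0) hlam10 (hj 0) (hj 1) (hmeet 0) (hmeet 1) (hlo 0) (hhi 1) h)
  · exact (hb 1).not_ge (hP.card_blue_block_le hn hlam (hlast 1) (hfirst 2) (by omega) (by omega)
      (by omega) (hblue 1) hlam10 (hj 1) (hj 2) (hmeet 1) (hmeet 2) (hlo 1) (hhi 2) h)
  -- The last gap ends at the copy of the first red block one period later; any further blocks lie
  -- before it and do no harm.
  · exact (hb 2).not_ge (hP.card_blue_block_le hn hlam (hlast 2) (hP3 ▸ hfirst 0) (by omega)
      (by omega) (by omega) (hblue 2) hlam10 (hj 2) hj3 (hmeet 2) (hmeet 0) (hlo 2)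
      (by rw [hA3]; push_cast; linarith [hhi 0]) h)

end PeriodicRays

/-! ### From block lists to the theorem, with the choice of constants. -/

lemma getElem_eq_of_append_replicate {L A D : List Color} {N : ℕ} {c : Color}
    (h : L = A ++ (List.replicate N c ++ D)) {i : ℕ} (hi : i < L.length) (h1 : A.length ≤ i)
    (h2 : i < A.length + N) : L[i] = c := by
  subst h
  rw [List.getElem_append_right h1, List.getElem_append_left (by simp; omega)]
  simp

lemma not_feasible_of_long_blocks {n : ℕ} {lam : ℝ} (hn : 0 < n) (hlam10 : 10 ≤ lam)
    {bl : List (ℕ × ℕ)} (hbl : 3 ≤ bl.length) {δ : ℝ} (hδ : 0 < δ)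
    (hr : ∀ rb ∈ bl, 6 * (δ * n / 2 + 1) < rb.1)
    (hw : 14 * (lam * (2 * Real.pi / n)) * (lam + 1) < δ ^ 3)
    (hb : ∀ rb ∈ bl, 3 * (5 / lam * n / 2 + 1) < rb.2) :
    ¬ Feasible (scaledRoots 1 n) (scaledRoots lam n) (ofBlocks bl) := by
  intro hf
  obtain ⟨⟨r₀, b₀⟩, ⟨r₁, b₁⟩, ⟨r₂, b₂⟩, rest, rfl⟩ :
      ∃ u v w rest, bl = u :: v :: w :: rest := by
    match bl, hbl with
    | u :: v :: w :: rest, _ => exact ⟨u, v, w, rest, rfl⟩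
  rw [ofBlocks] at hf
  set L : List Color := ((r₀, b₀) :: (r₁, b₁) :: (r₂, b₂) :: rest).flatMap fun rb =>
    List.replicate rb.1 Color.red ++ List.replicate rb.2 Color.blue with hL
  simp only [List.forall_mem_cons] at hr hb
  have hr0 : 0 < r₀ := by
    have h1 : 0 ≤ δ * n / 2 := by positivity
    have : (0 : ℝ) < r₀ := by linarith [hr.1]
    exact_mod_cast this
  have hlen : r₀ + b₀ + r₁ + b₁ + r₂ + b₂ ≤ L.length := by
    rw [hL]; simp; omega
  have hLne : L ≠ [] := by
    rw [← List.length_pos_iff]; omega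
  obtain ⟨d, ρ, P, θ, hP, hcol⟩ := exists_periodicRays hLne hf
  have hred : ∀ (A D : List Color) (N : ℕ), L = A ++ (List.replicate N Color.red ++ D) →
      ∀ i : ℤ, (A.length : ℤ) ≤ i → i < A.length + N → P i ∈ scaledRoots 1 n := by
    intro A D N h i h1 h2
    lift i to ℕ using by omega
    have hl : i < L.length := by rw [h]; simp; omega
    have h3 := hcol i hl
    rw [getElem_eq_of_append_replicate h hl (by omega) (by omega)] at h3
    by_contra hcon
    simp [hcon] at h3
  have hblue : ∀ (A D : List Color) (N : ℕ), L = A ++ (List.replicate N Color.blue ++ D) →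
      ∀ i : ℤ, (A.length : ℤ) ≤ i → i < A.length + N → P i ∈ scaledRoots lam n := by
    intro A D N h i h1 h2
    lift i to ℕ using by omega
    have hl : i < L.length := by rw [h]; simp; omega
    have h3 := hcol i hl
    rw [getElem_eq_of_append_replicate h hl (by omega) (by omega)] at h3
    refine (Finset.mem_union.mp (hP.mem i)).resolve_left fun hcon => ?_
    simp [hcon] at h3
  set D := rest.flatMap fun rb =>
    List.replicate rb.1 Color.red ++ List.replicate rb.2 Color.blue with hD
  set R := fun k => List.replicate k Color.red
  set B := fun k => List.replicate k Color.blue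
  have hLD : L = R r₀ ++ B b₀ ++ (R r₁ ++ B b₁ ++ (R r₂ ++ B b₂ ++ D)) := rfl
  have c0 := hred [] (B b₀ ++ (R r₁ ++ B b₁ ++ (R r₂ ++ B b₂ ++ D))) r₀ (by
    simp [hLD, R])
  have c1 := hblue (R r₀) (R r₁ ++ B b₁ ++ (R r₂ ++ B b₂ ++ D)) b₀ (by
    simp [hLD, B])
  have c2 := hred (R r₀ ++ B b₀) (B b₁ ++ (R r₂ ++ B b₂ ++ D)) r₁ (by
    simp [hLD, R])
  have c3 := hblue (R r₀ ++ B b₀ ++ R r₁) (R r₂ ++ B b₂ ++ D) b₁ (by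
    simp [hLD, B])
  have c4 := hred (R r₀ ++ B b₀ ++ R r₁ ++ B b₁) (B b₂ ++ D) r₂ (by
    simp [hLD, R])
  have c5 := hblue (R r₀ ++ B b₀ ++ R r₁ ++ B b₁ ++ R r₂) D b₂ (by
    simp [hLD, B])
  simp only [R, B, List.length_append, List.length_replicate, List.length_nil] at c0 c1 c2 c3 c4 c5
  refine hP.false_of_long_blocks hn (by linarith) hlam10 (r := ![r₀, r₁, r₂]) (b := ![b₀, b₁, b₂])
    (x := ![0, r₀ + b₀, r₀ + b₀ + r₁ + b₁]) hlen (by simp) (by simp) ?_ ?_ hδ ?_ hw ?_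
  · intro a i h1 h2
    fin_cases a
    · exact c0 i (by simpa using h1) (by simpa using h2)
    · exact c2 i (by simpa using h1) (by simpa using h2)
    · exact c4 i (by simpa using h1) (by simpa using h2)
  · intro a i h1 h2
    fin_cases a
    · exact c1 i (by simpa using h1) (by simpa using h2)
    · exact c3 i (by simpa using h1) (by simpa using h2)
    · exact c5 i (by simpa using h1) (by simpa using h2)
  · intro a
    fin_cases a
    exacts [hr.1, hr.2.1, hr.2.2.1]
  · intro a
    fin_cases a
    exacts [hb.1, hb.2.1, hb.2.2.1]

lemma not_feasible_largeBlockFamily {k l : ℝ} (hk : 0 < k) (hl : 0 < l) :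
    ∃ (n₀ : ℕ) (lam : ℝ), 1 < lam ∧ ∀ n : ℕ, n₀ < n → ∀ C ∈ largeBlockFamily k l n,
      ¬ Feasible (scaledRoots 1 n) (scaledRoots lam n) C := by
  have hpi := Real.pi_pos
  -- This gives 5/lam ≤ 1/(3l), so the bound on a blue block is at most n/(2l) + 3; the 10 ensures
  -- `10 ≤ lam`.
  set lam : ℝ := 15 * l + 10 with hlam
  set K : ℝ := 14 * (lam * (2 * Real.pi)) * (lam + 1) * (6 * k) ^ 3 with hK
  have hK0 : 0 ≤ K := by positivity
  -- Here n > 6l makes blue blocks too long, n > 12k does so for red blocks with δ = 1/(6k), and n >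
  -- K makes an arc of angle 2π/n narrow enough.
  refine ⟨⌈6 * l + 12 * k + K⌉₊, lam, by linarith, ?_⟩
  rintro n hn C ⟨-, bl, ⟨-, rfl⟩, hbl, hsize⟩
  have hn1 : 6 * l + 12 * k + K < n := (Nat.le_ceil _).trans_lt (by exact_mod_cast hn)
  have hn0 : (0 : ℝ) < n := by linarith
  refine not_feasible_of_long_blocks (by exact_mod_cast hn0) (by linarith) hbl
    (δ := 1 / (6 * k)) (by positivity) ?_ ?_ ?_
  · intro rb hrb
    refine lt_of_lt_of_le ?_ (hsize rb hrb).1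
    have h1 : 6 * (1 / (6 * k) * n / 2 + 1) = n / k / 2 + 6 := by field_simp
    have h2 : 12 < n / k := by rw [lt_div_iff₀ hk]; linarith
    linarith
  · have h1 : 14 * (lam * (2 * Real.pi / n)) * (lam + 1) = K / (6 * k) ^ 3 / n := by
      rw [hK]; field_simp
    rw [h1, one_div, inv_pow, div_lt_iff₀ hn0, div_eq_mul_inv, mul_comm]
    exact mul_lt_mul_of_pos_left (by linarith) (by positivity)
  · intro rb hrb
    refine lt_of_lt_of_le ?_ (hsize rb hrb).2
    have h1 : 3 * (5 / lam * n / 2 + 1) ≤ n / l / 2 + 3 := by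
      have : 5 / lam ≤ 1 / (3 * l) := by rw [div_le_div_iff₀] <;> linarith
      have h3 : 3 * (1 / (3 * l) * n / 2 + 1) = n / l / 2 + 3 := by field_simp
      rw [← h3]
      gcongr
    have h2 : 6 < n / l := by rw [lt_div_iff₀ hl]; linarith
    linarith

lemma not_isUniversal_of_not_feasible {n : ℕ} (hn : 0 < n) {lam : ℝ} (hlam : 1 < lam)
    {C : Cycle Color} (h : ¬ Feasible (scaledRoots 1 n) (scaledRoots lam n) C) :
    ¬ IsUniversal n C := fun hu =>
  h (hu _ _ (disjoint_scaledRoots hlam hn) (card_scaledRoots one_pos hn)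
    (card_scaledRoots (by linarith) hn))

lemma uniformConfiguration_mem_largeBlockFamily {k m : ℕ} (hk : 3 ≤ k) (hm : 0 < m) :
    uniformConfiguration k m ∈ largeBlockFamily k k (k * m) := by
  have hk0 : (k : ℝ) ≠ 0 := by
    have : k ≠ 0 := by omega
    exact_mod_cast this
  refine ⟨⟨?_, ?_⟩, List.replicate k (m, m), ⟨?_, rfl⟩, by simpa using hk, ?_⟩
  · simp [uniformConfiguration, ofBlocks, List.count_flatMap, List.count_replicate]
  · simp [uniformConfiguration, ofBlocks, List.count_flatMap, List.count_replicate]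
  · intro rb hrb
    rw [List.eq_of_mem_replicate hrb]
    exact ⟨hm, hm⟩
  · intro rb hrb
    rw [List.eq_of_mem_replicate hrb]
    push_cast
    rw [mul_div_cancel_left₀ _ hk0]
    exact ⟨le_rfl, le_rfl⟩

end ColoredRays

end

theorem mainTheorem12 :
    (∀ k l : ℝ, 0 < k → 0 < l → ∃ n₀ : ℕ, ∀ n : ℕ, n₀ < n →
      (∀ C ∈ ColoredRays.largeBlockFamily k l n, ¬ ColoredRays.IsUniversal n C) ∧
      ∃ lam : ℝ, 1 < lam ∧ ∀ C ∈ ColoredRays.largeBlockFamily k l n,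
        ¬ ColoredRays.Feasible (ColoredRays.scaledRoots 1 n) (ColoredRays.scaledRoots lam n) C) ∧
    (∀ k : ℕ, 3 ≤ k → ∃ n₀ : ℕ, ∀ n : ℕ, n₀ < n → ∀ m : ℕ, n = k * m →
      ¬ ColoredRays.IsUniversal n (ColoredRays.uniformConfiguration k m)) := by
  constructor
  · intro k l hk hl
    obtain ⟨n₀, lam, hlam, h⟩ := ColoredRays.not_feasible_largeBlockFamily hk hl
    exact ⟨n₀, fun n hn => ⟨fun C hC => ColoredRays.not_isUniversal_of_not_feasible (by omega) hlam
      (h n hn C hC), lam, hlam, h n hn⟩⟩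
  · intro k hk
    have hk0 : (0 : ℝ) < k := by exact_mod_cast (by omega : 0 < k)
    obtain ⟨n₀, lam, hlam, h⟩ := ColoredRays.not_feasible_largeBlockFamily hk0 hk0
    refine ⟨n₀, ?_⟩
    rintro n hn m rfl
    have hkm : 0 < k * m := by omega
    exact ColoredRays.not_isUniversal_of_not_feasible hkm hlam
      (h _ hn _ (ColoredRays.uniformConfiguration_mem_largeBlockFamily hk
        (Nat.pos_of_mul_pos_left hkm)))
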